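/- Let $H_n = 1+\frac12+\dots+\frac1n$. The function $h(s)=\sum_{n\ge 1} H_n n^{-s}$ ($\operatorname{Re} s>1$, where the series converges) has a meromorphic extension to $\mathbb{C}$, again denoted by $h$. Let $B(n)$ be the Bernoulli numbers with the convention $B(1)=+\frac12$ (so $\frac{z e^z}{e^z-1}=\sum_{n\ge0}\frac{B(n)}{n!}z^n$), and put $$A_n=\sum_{\substack{k+j=n\\ k\ge 1,\ j\ge 0}}\frac{B(k)}{k!\,k}\,\frac{B(j)}{j!}\qquad(n\ge 1).$$ Let $\zeta$ be the Riemann zeta function, $\psi=\Gamma'/\Gamma$, and $\gamma$ Euler's constant. Then for every integer $m\ge 2$, as $s\to 1-2m$, $s \ne 1-2m$, $$h(s)=\frac{\zeta(1-2m)}{s+2m-1}+(2m-1)!\,A_{2m}-\psi(2m)\,\zeta(1-2m)+O(s+2m-1).$$ Moreover $A_2=\frac{7}{24}$, and as $s\to-1$, $s\neq -1$, $$h(s)=\frac{-1}{12(s+1)}-\frac18-\frac{\gamma}{12}+O(s+1).$$ -/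

import Mathlib

open Filter Topology Asymptotics

/-- The convolution `A_n = ∑_{k + j = n, k ≥ 1, j ≥ 0} (B(k) / (k! k)) (B(j) / j!)` of Bernoulli
numbers, with the convention `B(1) = +1/2` (this is Mathlib's `bernoulli'`). -/
def bernoulliConv (n : ℕ) : ℚ :=
  ∑ p ∈ (Finset.HasAntidiagonal.antidiagonal n).filter (fun p => 1 ≤ p.1),
    bernoulli' p.1 / ((p.1.factorial : ℚ) * (p.1 : ℚ)) * (bernoulli' p.2 / (p.2.factorial : ℚ))

/-- `h` is the analytic extension, as a meromorphic function on the whole complex plane, of the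
Euler sum `∑_{n ≥ 1} H_n / n ^ s`, `Re s > 1`, where `H_n = 1 + 1/2 + ⋯ + 1/n`. The values of `h`
at its poles, or at other isolated points outside `Re s > 1`, are arbitrary. -/
structure IsEulerSumExtension (h : ℂ → ℂ) : Prop where
  meromorphic : Meromorphic h
  hasSum : ∀ s : ℂ, 1 < s.re →
    HasSum (fun n : ℕ => ((harmonic (n + 1) : ℚ) : ℂ) / ((n + 1 : ℕ) : ℂ) ^ s) (h s)

/-! For Re s > 1, Γ(s)h(s) is the Mellin transform of F(t) = ∑ H_n e^{-nt} =
-log(1-e^{-t})/(1-e^{-t}). With T(t) = te^t/(e^t-1) ∼ ∑ B(n)tⁿ/n! and L(t) = log((e^t-1)/t), one has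
tF = tT - TL - T log t. Since tL' = T - 1 and L(0+) = 0, L ∼ ∑ B(k)t^k/(k!k), so the coefficients of
TL are exactly the A_n.

Subtracting N terms of this expansion on (0,1] leaves a remainder with Mellin transform analytic on
Re s > 2 - N, while the terms t^{n-1} and t^{n-1} log t contribute 1/(s+n-1) and -1/(s+n-1)². This
continues h (`eulerSum`); the identity theorem (`IsEulerSumExtension.eventuallyEq`) transfers the
result to any extension.

At s = 1-2m the double pole, with c = B(2m)/(2m)! and d = B(2m-1)/(2m-1)! - A_{2m}, meets the simple
zero of 1/Γ, whose second-order term carries ψ(2m) (`Complex.inv_Gamma_isBigO`). Multiplying out and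
using ζ(1-2m) = -B(2m)/(2m) gives the claim (`isBigO_sub_principalPart`). -/

/-- `f` has the asymptotic expansion `p` at `0` from the right. -/
def HasAsymptoticExpansion (f : ℝ → ℝ) (p : PowerSeries ℝ) : Prop :=
  ∀ N : ℕ, (fun t => f t - (PowerSeries.trunc N p).eval t) =O[𝓝[>] 0] (fun t : ℝ => t ^ N)

/-! ### Calculus of one-sided asymptotic expansions -/

lemma Polynomial.isBigO_one_nhdsGT_zero (p : Polynomial ℝ) :
    (fun t => p.eval t) =O[𝓝[>] 0] (fun _ : ℝ => (1 : ℝ)) :=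
  ((p.continuous.tendsto 0).mono_left nhdsWithin_le_nhds).isBigO_one ℝ

lemma Polynomial.isBigO_pow_of_X_pow_dvd {p : Polynomial ℝ} {N : ℕ} (h : Polynomial.X ^ N ∣ p) :
    (fun t => p.eval t) =O[𝓝[>] 0] (fun t : ℝ => t ^ N) := by
  obtain ⟨q, rfl⟩ := h
  simpa using (isBigO_refl (fun t : ℝ => t ^ N) (𝓝[>] 0)).mul q.isBigO_one_nhdsGT_zero

namespace HasAsymptoticExpansion

variable {f g : ℝ → ℝ} {p q : PowerSeries ℝ}

lemma congr' (hf : HasAsymptoticExpansion f p) (h : f =ᶠ[𝓝[>] 0] g) :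
    HasAsymptoticExpansion g p := fun N =>
  (hf N).congr' (h.mono fun t ht => by simp only [ht]) EventuallyEq.rfl

lemma isBigO_one (hf : HasAsymptoticExpansion f p) :
    f =O[𝓝[>] 0] (fun _ : ℝ => (1 : ℝ)) := by
  simpa using hf 0

lemma add (hf : HasAsymptoticExpansion f p) (hg : HasAsymptoticExpansion g q) :
    HasAsymptoticExpansion (fun t => f t + g t) (p + q) := fun N =>
  ((hf N).add (hg N)).congr_left fun t => by
    simp only [map_add, Polynomial.eval_add]; ring

lemma neg (hf : HasAsymptoticExpansion f p) :
    HasAsymptoticExpansion (fun t => -f t) (-p) := fun N =>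
  (hf N).neg_left.congr_left fun t => by
    simp only [map_neg, Polynomial.eval_neg]; ring

lemma sub (hf : HasAsymptoticExpansion f p) (hg : HasAsymptoticExpansion g q) :
    HasAsymptoticExpansion (fun t => f t - g t) (p - q) := by
  simpa only [sub_eq_add_neg] using hf.add hg.neg

/-- With truncations P, Q: fg - trunc(pq) = (f-P)g + P(g-Q) + (PQ - trunc(pq)), and the last
polynomial is divisible by X^N. -/
lemma mul (hf : HasAsymptoticExpansion f p) (hg : HasAsymptoticExpansion g q) :
    HasAsymptoticExpansion (fun t => f t * g t) (p * q) := by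
  intro N
  have h1 := (hf N).mul hg.isBigO_one
  have h2 := (PowerSeries.trunc N p).isBigO_one_nhdsGT_zero.mul (hg N)
  have h3 : (Polynomial.X : Polynomial ℝ) ^ N ∣
      PowerSeries.trunc N p * PowerSeries.trunc N q - PowerSeries.trunc N (p * q) := by
    rw [Polynomial.X_pow_dvd_iff]
    intro d hd
    rw [← PowerSeries.trunc_trunc_mul_trunc, Polynomial.coeff_sub, PowerSeries.coeff_trunc,
      if_pos hd, ← Polynomial.coe_mul, Polynomial.coeff_coe, sub_self]
  have h4 := Polynomial.isBigO_pow_of_X_pow_dvd h3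
  simp only [mul_one, one_mul] at h1 h2
  refine ((h1.add h2).add h4).congr_left fun t => ?_
  simp only [Polynomial.eval_sub, Polynomial.eval_mul]
  ring

lemma ofPolynomial (r : Polynomial ℝ) :
    HasAsymptoticExpansion (fun t => r.eval t) (r : PowerSeries ℝ) := by
  intro N
  have h : (Polynomial.X : Polynomial ℝ) ^ N ∣ r - PowerSeries.trunc N (r : PowerSeries ℝ) := by
    rw [Polynomial.X_pow_dvd_iff]
    intro d hd
    rw [Polynomial.coeff_sub, PowerSeries.coeff_trunc, if_pos hd, Polynomial.coeff_coe, sub_self]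
  simpa using Polynomial.isBigO_pow_of_X_pow_dvd h

lemma one : HasAsymptoticExpansion (fun _ => 1) 1 := by
  simpa using ofPolynomial 1

lemma id : HasAsymptoticExpansion (fun t => t) PowerSeries.X := by
  simpa using ofPolynomial Polynomial.X

lemma exp : HasAsymptoticExpansion Real.exp (PowerSeries.exp ℝ) := by
  intro N
  refine ((Real.exp_sub_sum_range_isBigO_pow N).mono nhdsWithin_le_nhds).congr_left fun t => ?_
  rw [Polynomial.eval, PowerSeries.eval₂_trunc_eq_sum_range]
  simp [PowerSeries.coeff_exp, div_eq_inv_mul]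

lemma isBigO_pow_of_X_pow_dvd {N : ℕ} (hf : HasAsymptoticExpansion f p)
    (h : PowerSeries.X ^ N ∣ p) : f =O[𝓝[>] 0] (fun t : ℝ => t ^ N) := by
  have h0 : PowerSeries.trunc N p = 0 := by
    ext d
    rw [PowerSeries.coeff_trunc]
    split_ifs with hd
    · simpa using PowerSeries.X_pow_dvd_iff.1 h d hd
    · simp
  simpa [h0] using hf N

/-- Division of asymptotic expansions by a function `g` with a simple zero at `0`. -/
lemma of_mul (hfg : HasAsymptoticExpansion (fun t => f t * g t) (p * q))
    (hg : HasAsymptoticExpansion g q) (hq : PowerSeries.X ∣ q)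
    (hg0 : (fun t : ℝ => t) =O[𝓝[>] 0] g) : HasAsymptoticExpansion f p := by
  intro N
  have h1 := hfg.sub ((ofPolynomial (PowerSeries.trunc N p)).mul hg)
  -- The zero of q supplies one order beyond N; dividing by t at the end spends it.
  have h2 : (PowerSeries.X : PowerSeries ℝ) ^ (N + 1) ∣
      p * q - (PowerSeries.trunc N p : PowerSeries ℝ) * q := by
    rw [← sub_mul, pow_succ]
    refine mul_dvd_mul ?_ hq
    rw [PowerSeries.X_pow_dvd_iff]
    intro d hd
    rw [map_sub, Polynomial.coeff_coe, PowerSeries.coeff_trunc, if_pos hd, sub_self]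
  have h3 := h1.isBigO_pow_of_X_pow_dvd h2
  have h4 := ((isBigO_refl (fun t => f t - (PowerSeries.trunc N p).eval t) (𝓝[>] 0)).mul hg0).trans
    (h3.congr_left fun t => by ring)
  have h5 := h4.mul (isBigO_refl (fun t : ℝ => t⁻¹) (𝓝[>] 0))
  refine h5.congr' ?_ ?_ <;> filter_upwards [self_mem_nhdsWithin] with t ht
  · exact mul_inv_cancel_right₀ (ne_of_gt ht) _
  · rw [pow_succ]
    exact mul_inv_cancel_right₀ (ne_of_gt ht) _

/-- Termwise integration of an asymptotic expansion: if `t f'(t) ∼ p` and `f → 0`, then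
`f ∼ ∑ (p_k / k) t ^ k`. -/
lemma of_deriv {f' : ℝ → ℝ} (hderiv : ∀ t, 0 < t → HasDerivAt f (f' t) t)
    (hlim : Tendsto f (𝓝[>] 0) (𝓝 0))
    (hf' : HasAsymptoticExpansion (fun t => t * f' t) p) (hp : PowerSeries.coeff 0 p = 0) :
    HasAsymptoticExpansion f (PowerSeries.mk fun k => PowerSeries.coeff k p / k) := by
  intro N
  -- Order 0 only asks for boundedness; at order N + 1 the hypothesis on t f' bounds the error in f'
  -- by C t^N.
  rcases N with _ | N
  · simpa using hlim.isBigO_one ℝ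
  set q : PowerSeries ℝ := PowerSeries.mk fun k => PowerSeries.coeff k p / k with hq
  set Q := PowerSeries.trunc (N + 1) q with hQ
  have hXQ : Polynomial.X * Polynomial.derivative Q = PowerSeries.trunc (N + 1) p := by
    ext k
    rcases k with _ | k
    · simp [PowerSeries.coeff_trunc] at hp ⊢
      exact hp.symm
    · rw [Polynomial.coeff_X_mul, Polynomial.coeff_derivative, hQ, PowerSeries.coeff_trunc,
        PowerSeries.coeff_trunc]
      split_ifs
      · rw [hq, PowerSeries.coeff_mk]
        push_cast
        have : (k : ℝ) + 1 ≠ 0 := by positivity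
        field_simp
      · simp
  have hQ0 : Q.eval 0 = 0 := by
    rw [← Polynomial.coeff_zero_eq_eval_zero, hQ, PowerSeries.coeff_trunc]
    simp [hq]
  obtain ⟨C, hC⟩ := (hf' (N + 1)).bound
  obtain ⟨δ, hδ, hδ'⟩ := mem_nhdsGT_iff_exists_Ioo_subset.1 hC
  have hFlim : Tendsto (fun t => f t - Q.eval t) (𝓝[>] 0) (𝓝 0) := by
    have := hlim.sub ((Q.continuous.tendsto 0).mono_left nhdsWithin_le_nhds)
    simpa [hQ0] using this
  have hbound : ∀ t ∈ Set.Ioo 0 δ, ‖f' t - Q.derivative.eval t‖ ≤ C * t ^ N := by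
    intro t ht
    have h1 : ‖t * f' t - (PowerSeries.trunc (N + 1) p).eval t‖ ≤ C * ‖t ^ (N + 1)‖ := hδ' ht
    rw [← hXQ, Polynomial.eval_mul, Polynomial.eval_X, ← mul_sub, norm_mul, norm_pow,
      Real.norm_of_nonneg ht.1.le, pow_succ] at h1
    exact le_of_mul_le_mul_left (by linarith) ht.1
  refine IsBigO.of_bound C ?_
  filter_upwards [Ioo_mem_nhdsGT hδ] with t ht
  -- The value f(0) is not controlled, so the mean value inequality is applied on [ε, t] and then ε
  -- → 0.
  have hle : ∀ᶠ ε in 𝓝[>] (0 : ℝ),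
      ‖(f t - Q.eval t) - (f ε - Q.eval ε)‖ ≤ C * t ^ N * (t - ε) := by
    filter_upwards [Ioo_mem_nhdsGT ht.1] with ε hε
    have := (convex_Icc ε t).norm_image_sub_le_of_norm_hasDerivWithin_le
      (f := fun x => f x - Q.eval x) (f' := fun x => f' x - Q.derivative.eval x)
      (C := C * t ^ N) (x := ε) (y := t)
      (fun x hx => ((hderiv x (hε.1.trans_le hx.1)).sub (Q.hasDerivAt x)).hasDerivWithinAt)
      (fun x hx => (hbound x ⟨hε.1.trans_le hx.1, hx.2.trans_lt ht.2⟩).trans (by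
        have hx0 : 0 < x := hε.1.trans_le hx.1
        have hC0 : 0 ≤ C := by
          have := (norm_nonneg _).trans (hbound x ⟨hx0, hx.2.trans_lt ht.2⟩)
          exact nonneg_of_mul_nonneg_left this (by positivity)
        have := hx.2
        gcongr))
      ⟨le_rfl, hε.2.le⟩ ⟨hε.2.le, le_rfl⟩
    rwa [Real.norm_of_nonneg (sub_nonneg.2 hε.2.le)] at this
  have hlim1 : Tendsto (fun ε => ‖(f t - Q.eval t) - (f ε - Q.eval ε)‖) (𝓝[>] 0)
      (𝓝 ‖f t - Q.eval t‖) := by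
    simpa using (hFlim.const_sub (f t - Q.eval t)).norm
  have hlim2 : Tendsto (fun ε => C * t ^ N * (t - ε)) (𝓝[>] (0 : ℝ)) (𝓝 (C * t ^ N * t)) := by
    have : Tendsto (fun ε : ℝ => C * t ^ N * (t - ε)) (𝓝 0) (𝓝 (C * t ^ N * (t - 0))) :=
      (by fun_prop : Continuous fun ε : ℝ => C * t ^ N * (t - ε)).tendsto 0
    simpa using this.mono_left nhdsWithin_le_nhds
  have := le_of_tendsto_of_tendsto hlim1 hlim2 hle
  rw [norm_pow, Real.norm_of_nonneg ht.1.le, pow_succ, ← mul_assoc]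
  exact this

end HasAsymptoticExpansion

/-! ### The generating function and its expansion at 0 -/

/-- The generating function `∑_{n ≥ 1} H_n e^{-nt}`. -/
noncomputable def harmonicKernel (t : ℝ) : ℝ :=
  -Real.log (1 - Real.exp (-t)) / (1 - Real.exp (-t))

lemma HasSum.congr_terms {α ι : Type*} [AddCommMonoid α] [TopologicalSpace α] {f g : ι → α} {a : α}
    (hf : HasSum f a) (h : ∀ i, g i = f i) : HasSum g a := by
  rwa [funext h]

/-- Cauchy product of the series of -log(1-x) with the geometric series. -/
lemma hasSum_harmonic_mul_pow {x : ℝ} (hx0 : 0 ≤ x) (hx1 : x < 1) :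
    HasSum (fun n : ℕ => (harmonic (n + 1) : ℝ) * x ^ (n + 1)) (-Real.log (1 - x) / (1 - x)) := by
  have h1 := Real.hasSum_pow_div_log_of_abs_lt_one (x := x) (by rwa [abs_of_nonneg hx0])
  have h2 := hasSum_geometric_of_lt_one hx0 hx1
  have n1 : Summable fun n : ℕ => ‖x ^ (n + 1) / ((n : ℝ) + 1)‖ := h1.summable.norm
  have n2 : Summable fun n : ℕ => ‖x ^ n‖ := h2.summable.norm
  have h3 := tsum_mul_tsum_eq_tsum_sum_antidiagonal_of_summable_norm n1 n2
  have h4 := (summable_norm_sum_mul_antidiagonal_of_summable_norm n1 n2).of_norm.hasSum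
  rw [← h3, h1.tsum_eq, h2.tsum_eq, ← div_eq_mul_inv] at h4
  refine h4.congr_terms fun n => ?_
  rw [Finset.Nat.sum_antidiagonal_eq_sum_range_succ (fun i j => x ^ (i + 1) / ((i : ℝ) + 1) * x ^ j),
    harmonic, Rat.cast_sum, Finset.sum_mul]
  refine Finset.sum_congr rfl fun i hi => ?_
  have : n + 1 = (i + 1) + (n - i) := by
    have := Finset.mem_range.1 hi
    omega
  rw [this, pow_add]
  push_cast
  ring

lemma hasSum_harmonicKernel {t : ℝ} (ht : 0 < t) :
    HasSum (fun n : ℕ => (harmonic (n + 1) : ℝ) * Real.exp (-((n + 1 : ℕ) : ℝ) * t))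
      (harmonicKernel t) := by
  refine (hasSum_harmonic_mul_pow (Real.exp_pos (-t)).le (by simpa using ht)).congr_terms
    fun n => ?_
  rw [← Real.exp_nat_mul]
  congr 2
  ring

lemma one_sub_exp_neg_pos {t : ℝ} (ht : 0 < t) : 0 < 1 - Real.exp (-t) := by
  simpa using ht

lemma exp_sub_one_pos {t : ℝ} (ht : 0 < t) : 0 < Real.exp t - 1 := by
  simpa using ht

lemma continuousOn_harmonicKernel : ContinuousOn harmonicKernel (Set.Ioi 0) := by
  unfold harmonicKernel
  have h : ∀ t ∈ Set.Ioi (0 : ℝ), 1 - Real.exp (-t) ≠ 0 := fun t ht => (one_sub_exp_neg_pos ht).ne'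
  have hc : ContinuousOn (fun t : ℝ => 1 - Real.exp (-t)) (Set.Ioi 0) := by fun_prop
  exact (hc.log h).neg.div hc h

lemma harmonicKernel_isBigO_exp_neg :
    harmonicKernel =O[atTop] (fun t : ℝ => Real.exp (-1 * t)) := by
  -- For x = e^{-t} ≤ 1/2, -log(1-x) ≤ 1/(1-x) - 1 ≤ 2x, and dividing by 1-x ≥ 1/2 gives 4x.
  refine IsBigO.of_bound 4 ?_
  filter_upwards [eventually_ge_atTop (Real.log 2), eventually_gt_atTop 0] with t ht ht0
  have hx : Real.exp (-t) ≤ 1 / 2 := by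
    rw [Real.exp_neg, one_div]
    exact inv_anti₀ two_pos (by rwa [← Real.log_le_iff_le_exp two_pos])
  have hx0 := Real.exp_pos (-t)
  have hy := one_sub_exp_neg_pos ht0
  rw [harmonicKernel, neg_one_mul, Real.norm_of_nonneg hx0.le]
  set x := Real.exp (-t)
  have h1 := Real.one_sub_inv_le_log_of_pos hy
  have h2 := Real.log_nonpos hy.le (by linarith)
  have hinv : (1 - x)⁻¹ ≤ 1 + 2 * x := by
    rw [inv_le_iff_one_le_mul₀ hy]
    nlinarith
  rw [Real.norm_of_nonneg (div_nonneg (by linarith) hy.le), div_le_iff₀ hy]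
  nlinarith

/-- Obtained by dividing the formal identity T(e^t-1) = te^t by a simple zero, so convergence of the
Bernoulli series is never needed. -/
lemma hasAsymptoticExpansion_todd :
    HasAsymptoticExpansion (fun t => t * Real.exp t / (Real.exp t - 1)) (bernoulli'PowerSeries ℝ) := by
  refine HasAsymptoticExpansion.of_mul (g := fun t => Real.exp t - 1) (q := PowerSeries.exp ℝ - 1)
    ?_ (HasAsymptoticExpansion.exp.sub HasAsymptoticExpansion.one) ?_ ?_
  · rw [bernoulli'PowerSeries_mul_exp_sub_one]
    refine (HasAsymptoticExpansion.id.mul HasAsymptoticExpansion.exp).congr' ?_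
    filter_upwards [self_mem_nhdsWithin] with t ht
    rw [div_mul_cancel₀ _ (exp_sub_one_pos ht).ne']
  · rw [PowerSeries.X_dvd_iff]
    simp
  · refine IsBigO.of_bound 1 ?_
    filter_upwards [self_mem_nhdsWithin] with t ht
    rw [one_mul, Real.norm_of_nonneg (le_of_lt ht), Real.norm_of_nonneg (exp_sub_one_pos ht).le]
    linarith [Real.add_one_le_exp t]

/-- The expansion of `log ((e ^ t - 1) / t)`. -/
noncomputable def logToddPowerSeries : PowerSeries ℝ :=
  PowerSeries.mk fun k => PowerSeries.coeff k (bernoulli'PowerSeries ℝ - 1) / k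

lemma hasAsymptoticExpansion_log_exp_sub_one_div :
    HasAsymptoticExpansion (fun t => Real.log ((Real.exp t - 1) / t)) logToddPowerSeries := by
  refine HasAsymptoticExpansion.of_deriv
    (f' := fun t => Real.exp t / (Real.exp t - 1) - 1 / t) ?_ ?_ ?_ ?_
  · intro t ht
    have h : HasDerivAt (fun t => Real.log ((Real.exp t - 1) / t))
        ((Real.exp t * t - (Real.exp t - 1) * 1) / t ^ 2 / ((Real.exp t - 1) / t)) t :=
      (((Real.hasDerivAt_exp t).sub_const 1).div (hasDerivAt_id t) ht.ne').log
        (div_pos (exp_sub_one_pos ht) ht).ne'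
    convert h using 1
    have := exp_sub_one_pos ht
    field_simp
  · have h : Tendsto (fun t : ℝ => (Real.exp t - 1) / t) (𝓝[>] 0) (𝓝 1) := by
      have := (Real.hasDerivAt_exp 0).tendsto_slope_zero_right
      simpa [div_eq_inv_mul] using this
    simpa using h.log one_ne_zero
  · refine (hasAsymptoticExpansion_todd.sub HasAsymptoticExpansion.one).congr' ?_
    filter_upwards [self_mem_nhdsWithin] with t ht
    have h1 := exp_sub_one_pos ht
    have : t ≠ 0 := ne_of_gt ht
    field_simp
  · simp [bernoulli'PowerSeries]

lemma coeff_bernoulli'PowerSeries_mul_logTodd (n : ℕ) :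
    PowerSeries.coeff n (bernoulli'PowerSeries ℝ * logToddPowerSeries) = (bernoulliConv n : ℝ) := by
  rw [mul_comm, PowerSeries.coeff_mul, bernoulliConv, Finset.sum_filter, Rat.cast_sum]
  refine Finset.sum_congr rfl fun p _ => ?_
  rcases p with ⟨_ | k, j⟩
  -- At k = 0 the coefficient is a division by zero, hence 0, which matches the exclusion of k = 0
  -- from A_n.
  · simp [logToddPowerSeries]
  · simp [logToddPowerSeries, bernoulli'PowerSeries, PowerSeries.coeff_one, div_div]

/-- The coefficients of the non-logarithmic part of `t * harmonicKernel t`. -/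
noncomputable def harmonicKernelPowerSeries : PowerSeries ℝ :=
  PowerSeries.X * bernoulli'PowerSeries ℝ - bernoulli'PowerSeries ℝ * logToddPowerSeries

lemma coeff_harmonicKernelPowerSeries_succ (n : ℕ) :
    PowerSeries.coeff (n + 1) harmonicKernelPowerSeries =
      (bernoulli' n : ℝ) / n.factorial - (bernoulliConv (n + 1) : ℝ) := by
  rw [harmonicKernelPowerSeries, map_sub, PowerSeries.coeff_succ_X_mul,
    coeff_bernoulli'PowerSeries_mul_logTodd]
  simp [bernoulli'PowerSeries]

lemma hasAsymptoticExpansion_mul_harmonicKernel_add_log :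
    HasAsymptoticExpansion (fun t => t * harmonicKernel t +
      t * Real.exp t / (Real.exp t - 1) * Real.log t) harmonicKernelPowerSeries := by
  refine ((HasAsymptoticExpansion.id.mul hasAsymptoticExpansion_todd).sub
    (hasAsymptoticExpansion_todd.mul hasAsymptoticExpansion_log_exp_sub_one_div)).congr' ?_
  filter_upwards [self_mem_nhdsWithin] with t ht
  have h1 := exp_sub_one_pos ht
  have ht0 : t ≠ 0 := ne_of_gt ht
  have h2 : 1 - Real.exp (-t) = (Real.exp t - 1) / Real.exp t := by
    rw [Real.exp_neg]
    field_simp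
  rw [harmonicKernel, h2, Real.log_div h1.ne' (Real.exp_pos t).ne', Real.log_div h1.ne' ht0,
    Real.log_exp]
  field_simp
  ring

/-- From t^N, dividing by t costs one power, and a second full power is given up to absorb log t;
hence the exponent N - 2. -/
lemma harmonicKernel_sub_isBigO (N : ℕ) :
    (fun t => harmonicKernel t - ((PowerSeries.trunc N harmonicKernelPowerSeries).eval t -
      Real.log t * (PowerSeries.trunc N (bernoulli'PowerSeries ℝ)).eval t) / t)
      =O[𝓝[>] 0] (fun t : ℝ => t ^ (-(2 - N : ℝ))) := by
  have h1 := hasAsymptoticExpansion_mul_harmonicKernel_add_log N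
  have h2 : (fun t => t * Real.exp t / (Real.exp t - 1) -
      (PowerSeries.trunc N (bernoulli'PowerSeries ℝ)).eval t) =O[𝓝[>] 0]
      (fun t : ℝ => t ^ (-(-(N : ℝ)))) := by
    simpa using hasAsymptoticExpansion_todd N
  have h3 := isBigO_rpow_zero_log_smul (b := 1 - N) (by linarith) h2
  have h4 : (fun t : ℝ => t ^ N) =O[𝓝[>] 0] (fun t : ℝ => t ^ (-(1 - N : ℝ))) := by
    refine IsBigO.of_bound 1 ?_
    filter_upwards [Ioo_mem_nhdsGT one_pos] with t ht
    rw [one_mul, ← Real.rpow_natCast, Real.norm_of_nonneg (Real.rpow_nonneg ht.1.le _),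
      Real.norm_of_nonneg (Real.rpow_nonneg ht.1.le _)]
    exact Real.rpow_le_rpow_of_exponent_ge ht.1 ht.2.le (by linarith)
  refine (((h1.trans h4).sub h3).mul (isBigO_refl (fun t : ℝ => t⁻¹) (𝓝[>] 0))).congr' ?_ ?_ <;>
    filter_upwards [self_mem_nhdsWithin] with t ht
  · have ht0 : t ≠ 0 := ne_of_gt ht
    have h1 := exp_sub_one_pos ht
    simp only [smul_eq_mul]
    field_simp
    ring
  · rw [← Real.rpow_neg_one, ← Real.rpow_add ht]
    congr 1
    ring

/-! ### Mellin transforms of the terms of the expansion -/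

lemma MeasureTheory.LocallyIntegrableOn.indicator_Ioi {f : ℝ → ℂ} {s : Set ℝ}
    (hf : LocallyIntegrableOn f (Set.Ioi 0)) (hs : MeasurableSet s) :
    LocallyIntegrableOn (s.indicator f) (Set.Ioi 0) := by
  rw [locallyIntegrableOn_iff isOpen_Ioi.isLocallyClosed] at hf ⊢
  exact fun k hk hk' => (hf k hk hk').indicator hs

/-- `t ^ a` truncated to `(0, 1]`. -/
noncomputable def cpowIoc (a : ℂ) : ℝ → ℂ := Set.indicator (Set.Ioc 0 1) (fun t => (t : ℂ) ^ a)

lemma cpowIoc_eventuallyEq_atTop (a : ℂ) : cpowIoc a =ᶠ[atTop] fun _ => 0 := by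
  filter_upwards [eventually_gt_atTop 1] with t ht
  exact Set.indicator_of_notMem (fun h => absurd h.2 (not_le.2 ht)) _

lemma cpowIoc_eventuallyEq_nhdsGT (a : ℂ) : cpowIoc a =ᶠ[𝓝[>] 0] fun t => (t : ℂ) ^ a := by
  filter_upwards [Ioc_mem_nhdsGT one_pos] with t ht
  exact Set.indicator_of_mem ht _

lemma locallyIntegrableOn_cpowIoc (a : ℂ) :
    MeasureTheory.LocallyIntegrableOn (cpowIoc a) (Set.Ioi 0) := by
  refine MeasureTheory.LocallyIntegrableOn.indicator_Ioi ?_ measurableSet_Ioc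
  refine ContinuousOn.locallyIntegrableOn ?_ measurableSet_Ioi
  exact continuousOn_of_forall_continuousAt fun t ht =>
    Complex.continuousAt_ofReal_cpow_const _ _ (Or.inr (ne_of_gt ht))

lemma hasMellin_cpowIoc (a : ℂ) {s : ℂ} (hs : 0 < s.re + a.re) :
    HasMellin (cpowIoc a) s (1 / (s + a)) :=
  hasMellin_cpow_Ioc a hs

/-- A factor log t amounts to d/ds of the Mellin transform, here of 1/(s+a). -/
lemma hasMellin_log_smul_cpowIoc (a : ℂ) {s : ℂ} (hs : 0 < s.re + a.re) :
    HasMellin (fun t => Real.log t • cpowIoc a t) s (-1 / (s + a) ^ 2) := by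
  have h := mellin_hasDerivAt_of_isBigO_rpow (a := s.re + 1) (b := -a.re) (s := s)
    (locallyIntegrableOn_cpowIoc a)
    ((isBigO_zero _ _).congr' (cpowIoc_eventuallyEq_atTop a).symm EventuallyEq.rfl) (by linarith)
    (by
      refine IsBigO.of_bound 1 ?_
      filter_upwards [cpowIoc_eventuallyEq_nhdsGT a, self_mem_nhdsWithin] with t ht ht0
      rw [ht, Complex.norm_cpow_eq_rpow_re_of_pos ht0, neg_neg, one_mul]
      exact le_abs_self _) (by linarith)
  refine ⟨h.1, h.2.unique ?_⟩
  have hsa : s + a ≠ 0 := fun h0 => by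
    have := congrArg Complex.re h0
    rw [Complex.add_re, Complex.zero_re] at this
    linarith
  have h1 : HasDerivAt (fun z : ℂ => 1 / (z + a)) (-1 / (s + a) ^ 2) s := by
    simp only [one_div]
    exact ((hasDerivAt_id s).add_const a).inv hsa
  refine h1.congr_of_eventuallyEq ?_
  have : {z : ℂ | 0 < z.re + a.re} ∈ 𝓝 s :=
    (isOpen_lt continuous_const (Complex.continuous_re.add continuous_const)).mem_nhds hs
  filter_upwards [this] with z hz
  exact (hasMellin_cpowIoc a hz).2

/-- The `n`-th term of the asymptotic expansion of `harmonicKernel`, truncated to `(0, 1]`. -/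
noncomputable def kernelTerm (n : ℕ) (t : ℝ) : ℂ :=
  ((PowerSeries.coeff n harmonicKernelPowerSeries : ℝ) : ℂ) • cpowIoc (n - 1) t -
    ((PowerSeries.coeff n (bernoulli'PowerSeries ℝ) : ℝ) : ℂ) • (Real.log t • cpowIoc (n - 1) t)

/-- The Mellin transform of `kernelTerm n`. -/
noncomputable def kernelPole (n : ℕ) (s : ℂ) : ℂ :=
  ((PowerSeries.coeff n harmonicKernelPowerSeries : ℝ) : ℂ) / (s + (n - 1)) +
    ((PowerSeries.coeff n (bernoulli'PowerSeries ℝ) : ℝ) : ℂ) / (s + (n - 1)) ^ 2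

lemma hasMellin_kernelTerm (n : ℕ) {s : ℂ} (hs : 1 - n < s.re) :
    HasMellin (kernelTerm n) s (kernelPole n s) := by
  have hs' : 0 < s.re + ((n : ℂ) - 1).re := by simp; linarith
  have h1 := hasMellin_const_smul (hasMellin_cpowIoc (n - 1 : ℂ) hs').1
    ((PowerSeries.coeff n harmonicKernelPowerSeries : ℝ) : ℂ)
  have h2 := hasMellin_const_smul (hasMellin_log_smul_cpowIoc (n - 1 : ℂ) hs').1
    ((PowerSeries.coeff n (bernoulli'PowerSeries ℝ) : ℝ) : ℂ)
  have h3 := hasMellin_sub h1.1 h2.1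
  rw [h1.2, h2.2, (hasMellin_cpowIoc (n - 1 : ℂ) hs').2,
    (hasMellin_log_smul_cpowIoc (n - 1 : ℂ) hs').2] at h3
  have h4 : kernelPole n s = ((PowerSeries.coeff n harmonicKernelPowerSeries : ℝ) : ℂ) •
      (1 / (s + (n - 1))) - ((PowerSeries.coeff n (bernoulli'PowerSeries ℝ) : ℝ) : ℂ) •
      (-1 / (s + (n - 1)) ^ 2) := by
    rw [kernelPole, smul_eq_mul, smul_eq_mul]
    ring
  rwa [h4]

lemma sum_kernelTerm_eventuallyEq_nhdsGT (N : ℕ) :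
    (fun t => ∑ n ∈ Finset.range N, kernelTerm n t) =ᶠ[𝓝[>] 0] fun t =>
      (((PowerSeries.trunc N harmonicKernelPowerSeries).eval t -
        Real.log t * (PowerSeries.trunc N (bernoulli'PowerSeries ℝ)).eval t) / t : ℝ) := by
  filter_upwards [Ioc_mem_nhdsGT one_pos] with t ht
  have ht0 : (t : ℂ) ≠ 0 := by exact_mod_cast ht.1.ne'
  rw [Polynomial.eval, Polynomial.eval, PowerSeries.eval₂_trunc_eq_sum_range,
    PowerSeries.eval₂_trunc_eq_sum_range]
  simp only [RingHom.id_apply]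
  push_cast
  rw [Finset.mul_sum, ← Finset.sum_sub_distrib, Finset.sum_div]
  refine Finset.sum_congr rfl fun n _ => ?_
  have h : cpowIoc (n - 1) t = (t : ℂ) ^ n / t := by
    rw [cpowIoc, Set.indicator_of_mem ht, Complex.cpow_sub _ _ ht0, Complex.cpow_natCast,
      Complex.cpow_one]
  rw [kernelTerm, h, Complex.real_smul, smul_eq_mul, smul_eq_mul]
  ring

lemma sum_kernelTerm_eventuallyEq_atTop (N : ℕ) :
    (fun t => ∑ n ∈ Finset.range N, kernelTerm n t) =ᶠ[atTop] fun _ => 0 := by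
  filter_upwards [eventually_gt_atTop 1] with t ht
  refine Finset.sum_eq_zero fun n _ => ?_
  have h : cpowIoc (n - 1) t = 0 := Set.indicator_of_notMem (fun h => absurd h.2 (not_le.2 ht)) _
  simp [kernelTerm, h]

/-! ### Continuation of the Mellin transform -/

/-- The remainder of the asymptotic expansion of `harmonicKernel` at `0`. -/
noncomputable def kernelRemainder (N : ℕ) (t : ℝ) : ℂ :=
  (harmonicKernel t : ℂ) - ∑ n ∈ Finset.range N, kernelTerm n t

lemma locallyIntegrableOn_kernelTerm (n : ℕ) :
    MeasureTheory.LocallyIntegrableOn (kernelTerm n) (Set.Ioi 0) := by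
  have h := locallyIntegrableOn_cpowIoc ((n : ℂ) - 1)
  have hlog : MeasureTheory.LocallyIntegrableOn
      (fun t => Real.log t • cpowIoc ((n : ℂ) - 1) t) (Set.Ioi 0) :=
    h.continuousOn_smul isOpen_Ioi.isLocallyClosed
      (Real.continuousOn_log.mono fun t ht => ne_of_gt ht)
  exact (h.smul ((PowerSeries.coeff n harmonicKernelPowerSeries : ℝ) : ℂ)).sub
    (hlog.smul ((PowerSeries.coeff n (bernoulli'PowerSeries ℝ) : ℝ) : ℂ))

lemma locallyIntegrableOn_kernelRemainder (N : ℕ) :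
    MeasureTheory.LocallyIntegrableOn (kernelRemainder N) (Set.Ioi 0) := by
  have h0 : MeasureTheory.LocallyIntegrableOn (fun t => (harmonicKernel t : ℂ)) (Set.Ioi 0) :=
    (Complex.continuous_ofReal.comp_continuousOn continuousOn_harmonicKernel).locallyIntegrableOn
      measurableSet_Ioi
  induction N with
  | zero =>
    have : kernelRemainder 0 = fun t => (harmonicKernel t : ℂ) := by
      ext t
      simp [kernelRemainder]
    rwa [this]
  | succ N ih =>
    refine (ih.sub (locallyIntegrableOn_kernelTerm N)).congr ?_
    refine Eventually.of_forall fun t => ?_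
    simp only [Pi.sub_apply, kernelRemainder, Finset.sum_range_succ]
    ring

lemma kernelRemainder_isBigO_atTop (N : ℕ) :
    kernelRemainder N =O[atTop] (fun t : ℝ => Real.exp (-1 * t)) := by
  have h : (fun t => (harmonicKernel t : ℂ)) =O[atTop] (fun t : ℝ => Real.exp (-1 * t)) :=
    IsBigO.of_norm_left (by
      simpa only [Complex.norm_real] using harmonicKernel_isBigO_exp_neg.norm_left)
  refine h.congr' ?_ EventuallyEq.rfl
  filter_upwards [sum_kernelTerm_eventuallyEq_atTop N] with t ht
  rw [kernelRemainder, ht, sub_zero]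

lemma kernelRemainder_isBigO_nhdsGT (N : ℕ) :
    kernelRemainder N =O[𝓝[>] 0] (fun t : ℝ => t ^ (-(2 - N : ℝ))) := by
  refine IsBigO.of_norm_left ((harmonicKernel_sub_isBigO N).norm_left.congr' ?_ EventuallyEq.rfl)
  filter_upwards [sum_kernelTerm_eventuallyEq_nhdsGT N] with t ht
  rw [kernelRemainder, ht, ← Complex.ofReal_sub, Complex.norm_real]

lemma mellinConvergent_kernelRemainder (N : ℕ) {s : ℂ} (hs : 2 - N < s.re) :
    MellinConvergent (kernelRemainder N) s :=
  mellinConvergent_of_isBigO_rpow_exp one_pos (locallyIntegrableOn_kernelRemainder N)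
    (kernelRemainder_isBigO_atTop N) (kernelRemainder_isBigO_nhdsGT N) hs

lemma differentiableAt_mellin_kernelRemainder (N : ℕ) {s : ℂ} (hs : 2 - N < s.re) :
    DifferentiableAt ℂ (mellin (kernelRemainder N)) s :=
  mellin_differentiableAt_of_isBigO_rpow_exp one_pos (locallyIntegrableOn_kernelRemainder N)
    (kernelRemainder_isBigO_atTop N) (kernelRemainder_isBigO_nhdsGT N) hs

/-- The continuation of the Mellin transform of `harmonicKernel` to `2 - N < Re s`. -/
noncomputable def kernelMellin (N : ℕ) (s : ℂ) : ℂ :=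
  mellin (kernelRemainder N) s + ∑ n ∈ Finset.range N, kernelPole n s

/-- Consecutive remainders differ by one term, whose Mellin transform converges on this half-plane
and is the added pole. -/
lemma kernelMellin_succ (N : ℕ) {s : ℂ} (hs : 2 - N < s.re) :
    kernelMellin (N + 1) s = kernelMellin N s := by
  have h := hasMellin_add
    (mellinConvergent_kernelRemainder (N + 1) (s := s) (by push_cast; linarith))
    (hasMellin_kernelTerm N (s := s) (by linarith)).1
  have h2 : (fun t => kernelRemainder (N + 1) t + kernelTerm N t) = kernelRemainder N := by
    ext t
    simp only [kernelRemainder, Finset.sum_range_succ]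
    ring
  rw [kernelMellin, kernelMellin, Finset.sum_range_succ, ← h2, h.2,
    (hasMellin_kernelTerm N (by linarith)).2]
  ring

lemma kernelMellin_of_le {N M : ℕ} (hNM : N ≤ M) {s : ℂ} (hs : 2 - N < s.re) :
    kernelMellin M s = kernelMellin N s := by
  induction M, hNM using Nat.le_induction with
  | base => rfl
  | succ M hM ih =>
    have : (N : ℝ) ≤ M := by exact_mod_cast hM
    rw [kernelMellin_succ M (by linarith), ih]

lemma kernelMellin_one {s : ℂ} (hs : 1 < s.re) :
    kernelMellin 1 s = mellin (fun t => (harmonicKernel t : ℂ)) s := by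
  have h1 := hasMellin_kernelTerm 0 (s := s) (by simpa using hs)
  have h := hasMellin_add (mellinConvergent_kernelRemainder 1 (s := s) (by norm_num; exact hs)) h1.1
  rw [kernelMellin, Finset.sum_range_one, ← h1.2, ← h.2]
  congr 1
  ext t
  simp [kernelRemainder]

/-! ### Existence and uniqueness of the meromorphic extension -/

/-- The meromorphic continuation of `∑ H_n n ^ (-s)`. -/
noncomputable def eulerSum (s : ℂ) : ℂ :=
  (Complex.Gamma s)⁻¹ * kernelMellin ⌈3 - s.re⌉₊ s

/-- The ceiling in `eulerSum` satisfies 2 - N ≤ Re s - 1 < Re s; any other admissible N gives the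
same value, so locally N may be held fixed. -/
lemma eulerSum_eq (N : ℕ) {s : ℂ} (hs : 2 - N < s.re) :
    eulerSum s = (Complex.Gamma s)⁻¹ * kernelMellin N s := by
  rw [eulerSum]
  congr 1
  rcases le_total N ⌈3 - s.re⌉₊ with h | h
  · exact kernelMellin_of_le h hs
  · refine (kernelMellin_of_le h ?_).symm
    linarith [Nat.le_ceil (3 - s.re)]

lemma eulerSum_eventuallyEq (N : ℕ) {s : ℂ} (hs : 2 - N < s.re) :
    eulerSum =ᶠ[𝓝 s] fun z => (Complex.Gamma z)⁻¹ * kernelMellin N z := by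
  filter_upwards [(isOpen_lt continuous_const Complex.continuous_re).mem_nhds hs] with z hz
  exact eulerSum_eq N hz

lemma analyticAt_mellin_kernelRemainder (N : ℕ) {s : ℂ} (hs : 2 - N < s.re) :
    AnalyticAt ℂ (mellin (kernelRemainder N)) s := by
  have ho : IsOpen {z : ℂ | (2 - N : ℝ) < z.re} := isOpen_lt continuous_const Complex.continuous_re
  exact DifferentiableOn.analyticAt
    (fun z hz => (differentiableAt_mellin_kernelRemainder N hz).differentiableWithinAt)
    (ho.mem_nhds hs)

lemma meromorphicAt_kernelPole (n : ℕ) (s : ℂ) : MeromorphicAt (kernelPole n) s := by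
  unfold kernelPole
  fun_prop

lemma meromorphic_eulerSum : Meromorphic eulerSum := by
  intro s
  have hs : 2 - (⌈3 - s.re⌉₊ : ℝ) < s.re := by linarith [Nat.le_ceil (3 - s.re)]
  refine MeromorphicAt.congr ?_ ((eulerSum_eventuallyEq _ hs).symm.filter_mono nhdsWithin_le_nhds)
  refine (Complex.differentiable_one_div_Gamma.analyticAt s).meromorphicAt.mul ?_
  refine (analyticAt_mellin_kernelRemainder _ hs).meromorphicAt.add ?_
  exact MeromorphicAt.fun_sum fun n _ => meromorphicAt_kernelPole n s

lemma summable_harmonic_div_rpow {σ : ℝ} (hσ : 1 < σ) :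
    Summable fun n : ℕ => (harmonic (n + 1) : ℝ) / ((n + 1 : ℕ) : ℝ) ^ σ := by
  -- H_n ≤ 1 + log n ≤ (1 + 1/ε) n^ε, and this ε keeps σ - ε > 1.
  obtain ⟨ε, hε⟩ : ∃ ε, ε = (σ - 1) / 2 := ⟨_, rfl⟩
  have hε0 : 0 < ε := by rw [hε]; linarith
  have h1 : Summable fun n : ℕ => (1 + 1 / ε) * (1 / ((n + 1 : ℕ) : ℝ) ^ (σ - ε)) :=
    (((summable_nat_add_iff 1).2
      (Real.summable_one_div_nat_rpow (p := σ - ε).2 (by rw [hε]; linarith)))).mul_left _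
  refine h1.of_nonneg_of_le (fun n => ?_) fun n => ?_
  · have : (0 : ℝ) ≤ harmonic (n + 1) := by
      exact_mod_cast (harmonic_pos n.succ_ne_zero).le
    positivity
  · have hn : (1 : ℝ) ≤ ((n + 1 : ℕ) : ℝ) := by simp
    have hn0 : (0 : ℝ) < ((n + 1 : ℕ) : ℝ) := by linarith
    have h2 := harmonic_le_one_add_log (n + 1)
    have h3 := Real.log_le_rpow_div hn0.le hε0
    have h4 := Real.one_le_rpow hn hε0.le
    rw [Real.rpow_sub hn0, one_div_div, mul_div_assoc']
    refine div_le_div_of_nonneg_right ?_ (by positivity)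
    rw [one_add_mul, one_div_mul_eq_div]
    linarith

lemma isEulerSumExtension_eulerSum : IsEulerSumExtension eulerSum where
  meromorphic := meromorphic_eulerSum
  hasSum s hs := by
    have h := hasSum_mellin (a := fun n : ℕ => ((harmonic (n + 1) : ℝ) : ℂ))
      (p := fun n : ℕ => ((n + 1 : ℕ) : ℝ)) (F := fun t => (harmonicKernel t : ℂ)) (s := s)
      (fun n => Or.inr (by positivity)) (by linarith)
      (fun t ht => by exact_mod_cast hasSum_harmonicKernel ht)
      (by
        refine (summable_harmonic_div_rpow hs).congr fun n => ?_
        have : (0 : ℝ) ≤ harmonic (n + 1) := by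
          exact_mod_cast (harmonic_pos n.succ_ne_zero).le
        rw [Complex.norm_real, Real.norm_of_nonneg this])
    have hΓ : Complex.Gamma s ≠ 0 := Complex.Gamma_ne_zero_of_re_pos (by linarith)
    rw [eulerSum_eq 1 (by norm_num; exact hs), kernelMellin_one hs]
    refine (h.mul_left (Complex.Gamma s)⁻¹).congr_terms fun n => ?_
    rw [mul_div_assoc, inv_mul_cancel_left₀ hΓ]
    push_cast
    rfl

/-- Identity theorem: the difference has order ⊤ at 2, hence at every point of ℂ. Only punctured
neighbourhoods are reached, as values at poles are arbitrary. -/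
lemma IsEulerSumExtension.eventuallyEq {h₁ h₂ : ℂ → ℂ} (H₁ : IsEulerSumExtension h₁)
    (H₂ : IsEulerSumExtension h₂) (s : ℂ) : h₁ =ᶠ[𝓝[≠] s] h₂ := by
  have hm : Meromorphic (h₁ - h₂) := H₁.meromorphic.sub H₂.meromorphic
  have h2 : meromorphicOrderAt (h₁ - h₂) 2 = ⊤ := by
    rw [meromorphicOrderAt_eq_top_iff]
    refine Eventually.filter_mono nhdsWithin_le_nhds ?_
    have : {z : ℂ | 1 < z.re} ∈ 𝓝 (2 : ℂ) :=
      (isOpen_lt continuous_const Complex.continuous_re).mem_nhds (by norm_num)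
    filter_upwards [this] with z hz
    exact sub_eq_zero.2 ((H₁.hasSum z hz).unique (H₂.hasSum z hz))
  have hs : meromorphicOrderAt (h₁ - h₂) s = ⊤ := by
    by_contra hne
    exact hm.exists_meromorphicOrderAt_ne_top_iff_forall.1 ⟨s, hne⟩ 2 h2
  filter_upwards [meromorphicOrderAt_eq_top_iff.1 hs] with z hz
  exact sub_eq_zero.1 hz

/-! ### Laurent expansion at 1 - 2m -/

lemma mul_double_pole_isBigO {g E : ℂ → ℂ} {s₀ α β c d : ℂ}
    (hg : (fun s => g s - (α * (s - s₀) + β * (s - s₀) ^ 2)) =O[𝓝 s₀] fun s => (s - s₀) ^ 3)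
    (hE : E =O[𝓝 s₀] fun _ => (1 : ℂ)) :
    (fun s => g s * (c / (s - s₀) ^ 2 + d / (s - s₀) + E s) -
      (α * c / (s - s₀) + (α * d + β * c))) =O[𝓝[≠] s₀] fun s => s - s₀ := by
  have hcont : ∀ p : ℂ → ℂ, Continuous p → p =O[𝓝 s₀] fun _ => (1 : ℂ) := fun p hp =>
    (hp.tendsto s₀).isBigO_one ℂ
  have h1 : (fun s => c + d * (s - s₀) + E s * (s - s₀) ^ 2) =O[𝓝 s₀] fun _ => (1 : ℂ) := by
    refine (hcont _ (by fun_prop)).add ?_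
    simpa only [mul_one] using hE.mul (hcont (fun s => (s - s₀) ^ 2) (by fun_prop))
  have h2 := (hg.mul h1).mono (nhdsWithin_le_nhds (s := {s₀}ᶜ))
  have h3 := h2.mul (isBigO_refl (fun s => ((s - s₀) ^ 2)⁻¹) (𝓝[≠] s₀))
  have h4 : (fun s => (β * d + (α + β * (s - s₀)) * E s) * (s - s₀)) =O[𝓝 s₀]
      fun s => s - s₀ := by
    have : (fun s => β * d + (α + β * (s - s₀)) * E s) =O[𝓝 s₀] fun _ => (1 : ℂ) := by
      refine (hcont _ (by fun_prop)).add ?_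
      simpa using (hcont (fun s => α + β * (s - s₀)) (by fun_prop)).mul hE
    simpa using this.mul (isBigO_refl (fun s => s - s₀) (𝓝 s₀))
  have h5 : (fun s : ℂ => (s - s₀) ^ 3 * 1 * ((s - s₀) ^ 2)⁻¹) =O[𝓝[≠] s₀] fun s => s - s₀ := by
    refine (isBigO_refl _ _).congr' ?_ EventuallyEq.rfl
    filter_upwards [self_mem_nhdsWithin] with s hs
    have : s - s₀ ≠ 0 := sub_ne_zero.2 hs
    field_simp
  refine ((h3.trans h5).add (h4.mono nhdsWithin_le_nhds)).congr' ?_ EventuallyEq.rfl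
  filter_upwards [self_mem_nhdsWithin] with s hs
  have : s - s₀ ≠ 0 := sub_ne_zero.2 hs
  field_simp
  ring

/-- In sin z = (e^{-iz} - e^{iz})i/2 the quadratic Taylor terms cancel. -/
lemma Complex.sin_sub_self_isBigO : (fun z => sin z - z) =O[𝓝 0] fun z : ℂ => z ^ 3 := by
  have h := Complex.exp_sub_sum_range_isBigO_pow 3
  have h1 : Tendsto (fun z : ℂ => z * I) (𝓝 0) (𝓝 0) := by
    simpa using (by fun_prop : Continuous fun z : ℂ => z * I).tendsto 0
  have h2 : Tendsto (fun z : ℂ => -z * I) (𝓝 0) (𝓝 0) := by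
    simpa using (by fun_prop : Continuous fun z : ℂ => -z * I).tendsto 0
  have e1 : (fun z : ℂ => (z * I) ^ 3) =O[𝓝 0] fun z : ℂ => z ^ 3 :=
    IsBigO.of_bound 1 (Eventually.of_forall fun z => by simp)
  have e2 : (fun z : ℂ => (-z * I) ^ 3) =O[𝓝 0] fun z : ℂ => z ^ 3 :=
    IsBigO.of_bound 1 (Eventually.of_forall fun z => by simp)
  have h3 := (((h.comp_tendsto h2).trans e2).sub ((h.comp_tendsto h1).trans e1)).const_mul_left (I / 2)
  refine h3.congr_left fun z => ?_
  simp only [Function.comp_apply, Finset.sum_range_succ, Finset.sum_range_zero, Complex.sin]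
  simp
  linear_combination z * I_sq

lemma AnalyticAt.isBigO_sub_sq {f : ℂ → ℂ} {x : ℂ} (hf : AnalyticAt ℂ f x) :
    (fun y => f (x + y) - (f x + deriv f x * y)) =O[𝓝 0] fun y => y ^ 2 := by
  obtain ⟨p, hp⟩ := hf
  have h := hp.isBigO_sub_partialSum_pow 2
  simp only [← norm_pow] at h
  refine h.of_norm_right.congr_left fun y => ?_
  have h0 : p 0 (fun _ => y) = f x := hp.coeff_zero _
  have h1 : p 1 (fun _ => y) = deriv f x * y := by
    rw [FormalMultilinearSeries.apply_eq_pow_smul_coeff, pow_one, hp.deriv, smul_eq_mul, mul_comm]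
    rfl
  rw [FormalMultilinearSeries.partialSum, Finset.sum_range_succ, Finset.sum_range_one, h0, h1]

lemma Complex.analyticAt_Gamma_of_re_pos {s : ℂ} (hs : 0 < s.re) : AnalyticAt ℂ Gamma s := by
  refine DifferentiableOn.analyticAt (s := {z : ℂ | 0 < z.re}) (fun z hz => ?_)
    ((isOpen_lt continuous_const continuous_re).mem_nhds hs)
  refine (differentiableAt_Gamma z fun m hm => ?_).differentiableWithinAt
  have hz' : 0 < z.re := hz
  rw [hm] at hz'
  simp at hz'
  linarith [(Nat.cast_nonneg m : (0 : ℝ) ≤ m)]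

lemma Complex.inv_Gamma_eq (m : ℕ) {e : ℂ} (he : 0 < (2 * (m : ℂ) - e).re) :
    (Gamma (1 - 2 * m + e))⁻¹ = -Gamma (2 * m - e) * sin (Real.pi * e) / Real.pi := by
  have h := Gamma_mul_Gamma_one_sub (1 - 2 * m + e)
  rw [show 1 - (1 - 2 * (m : ℂ) + e) = 2 * m - e by ring,
    show (Real.pi : ℂ) * (1 - 2 * m + e) = (Real.pi * e + Real.pi) - m * (2 * Real.pi) by ring,
    sin_sub_nat_mul_two_pi, sin_add_pi] at h
  have hΓ := Gamma_ne_zero_of_re_pos he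
  rw [← eq_div_iff hΓ] at h
  rw [h, inv_div, div_div_eq_mul_div, mul_neg, neg_mul]

/-- By reflection, 1/Γ(1-2m+e) = -Γ(2m-e) sin(πe)/π; expand Γ to first order and the sine with cubic
error. -/
lemma Complex.inv_Gamma_isBigO {m : ℕ} (hm : 0 < m) :
    (fun s => (Gamma s)⁻¹ - (-Gamma (2 * m) * (s - (1 - 2 * m)) +
      deriv Gamma (2 * m) * (s - (1 - 2 * m)) ^ 2)) =O[𝓝 (1 - 2 * m : ℂ)]
      fun s => (s - (1 - 2 * m)) ^ 3 := by
  have hm' : (0 : ℝ) < m := by exact_mod_cast hm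
  have hpi : (Real.pi : ℂ) ≠ 0 := by exact_mod_cast Real.pi_ne_zero
  have han : AnalyticAt ℂ Gamma (2 * m) := analyticAt_Gamma_of_re_pos (by simpa using hm)
  have t1 : Tendsto (fun e : ℂ => -e) (𝓝 0) (𝓝 0) := by
    simpa using (continuous_neg (G := ℂ)).tendsto 0
  have t2 : Tendsto (fun e : ℂ => Real.pi * e) (𝓝 0) (𝓝 0) := by
    simpa using (continuous_const_mul (Real.pi : ℂ)).tendsto 0
  have g1 : (fun e : ℂ => Gamma (2 * m + -e) - (Gamma (2 * m) + deriv Gamma (2 * m) * -e))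
      =O[𝓝 0] fun e => e ^ 2 :=
    (han.isBigO_sub_sq.comp_tendsto t1).congr_right fun e => by simp
  have g2 : (fun e : ℂ => sin (Real.pi * e) - Real.pi * e) =O[𝓝 0] fun e => e ^ 3 := by
    refine (sin_sub_self_isBigO.comp_tendsto t2).trans ?_
    simp only [Function.comp_def, mul_pow]
    exact (isBigO_refl _ _).const_mul_left _
  have g3 : (fun e : ℂ => Gamma (2 * m + -e)) =O[𝓝 0] fun _ => (1 : ℂ) := by
    have : Tendsto (fun e : ℂ => Gamma (2 * m + -e)) (𝓝 0) (𝓝 (Gamma (2 * m))) := by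
      refine han.continuousAt.tendsto.comp ?_
      simpa using t1.const_add (2 * (m : ℂ))
    exact this.isBigO_one ℂ
  have g4 := ((g3.mul g2).const_mul_left (-(Real.pi : ℂ)⁻¹)).sub
    (((isBigO_refl (fun e : ℂ => e) (𝓝 0)).mul g1).congr_right (g₂ := fun e => 1 * e ^ 3)
      fun e => by ring)
  have t3 : Tendsto (fun s : ℂ => s - (1 - 2 * m)) (𝓝 (1 - 2 * m : ℂ)) (𝓝 0) := by
    simpa using (continuous_sub_right (1 - 2 * m : ℂ)).tendsto (1 - 2 * m)
  refine (g4.comp_tendsto t3).congr' ?_ (Eventually.of_forall fun s => by simp)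
  have hpos : ∀ᶠ s in 𝓝 (1 - 2 * m : ℂ), 0 < (2 * (m : ℂ) - (s - (1 - 2 * m))).re :=
    (isOpen_lt continuous_const (by fun_prop)).mem_nhds (by simpa using hm)
  filter_upwards [hpos] with s hs
  have h := inv_Gamma_eq m hs
  rw [add_sub_cancel] at h
  rw [h]
  simp only [Function.comp_apply, ← sub_eq_add_neg]
  field_simp
  ring

lemma analyticAt_kernelPole {n : ℕ} {s : ℂ} (h : s + (n - 1) ≠ 0) :
    AnalyticAt ℂ (kernelPole n) s := by
  unfold kernelPole
  have h2 := pow_ne_zero 2 h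
  fun_prop (disch := assumption)

/-- With N = 2m+2 the remainder is analytic on Re s > -2m, which contains 1-2m, and the terms n ≠ 2m
have their poles elsewhere. -/
lemma kernelMellin_eq_double_pole (m : ℕ) :
    ∃ E : ℂ → ℂ, E =O[𝓝 (1 - 2 * m : ℂ)] (fun _ => (1 : ℂ)) ∧ ∀ s,
      kernelMellin (2 * m + 2) s =
        ((PowerSeries.coeff (2 * m) (bernoulli'PowerSeries ℝ) : ℝ) : ℂ) / (s - (1 - 2 * m)) ^ 2 +
        ((PowerSeries.coeff (2 * m) harmonicKernelPowerSeries : ℝ) : ℂ) / (s - (1 - 2 * m)) +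
        E s := by
  refine ⟨fun s => mellin (kernelRemainder (2 * m + 2)) s +
    ∑ n ∈ (Finset.range (2 * m + 2)).erase (2 * m), kernelPole n s, ?_, fun s => ?_⟩
  · have h : AnalyticAt ℂ (fun s => mellin (kernelRemainder (2 * m + 2)) s +
        ∑ n ∈ (Finset.range (2 * m + 2)).erase (2 * m), kernelPole n s) (1 - 2 * m : ℂ) := by
      refine (analyticAt_mellin_kernelRemainder _ (by simp)).add ?_
      refine Finset.analyticAt_fun_sum _ fun n hn => analyticAt_kernelPole fun h0 => ?_
      refine (Finset.mem_erase.1 hn).1 ?_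
      have : (n : ℂ) = (2 * m : ℕ) := by
        push_cast
        linear_combination h0
      exact_mod_cast this
    exact h.continuousAt.tendsto.isBigO_one ℂ
  · have hs : s + (((2 * m : ℕ) : ℂ) - 1) = s - (1 - 2 * m) := by
      push_cast
      ring
    rw [kernelMellin, ← Finset.add_sum_erase _ _ (Finset.mem_range.2 (by lia : 2 * m < 2 * m + 2)),
      kernelPole, hs]
    ring

/-- Keeping B(2m-1) treats all m ≥ 1 at once: it vanishes for m ≥ 2 and is 1/2 for m = 1. -/
lemma IsEulerSumExtension.isBigO_sub_principalPart {h : ℂ → ℂ} (hh : IsEulerSumExtension h) {m : ℕ}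
    (hm : 0 < m) :
    (fun s : ℂ => h s -
      (riemannZeta (1 - 2 * (m : ℂ)) / (s + 2 * (m : ℂ) - 1)
        + ((2 * m - 1).factorial : ℂ) * ((bernoulliConv (2 * m) : ℚ) : ℂ)
        - ((bernoulli' (2 * m - 1) : ℚ) : ℂ)
        - Complex.digamma (2 * (m : ℂ)) * riemannZeta (1 - 2 * (m : ℂ))))
      =O[𝓝[≠] (1 - 2 * (m : ℂ))] (fun s : ℂ => s + 2 * (m : ℂ) - 1) := by
  obtain ⟨E, hE, hEs⟩ := kernelMellin_eq_double_pole m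
  have key := mul_double_pole_isBigO
    (c := ((PowerSeries.coeff (2 * m) (bernoulli'PowerSeries ℝ) : ℝ) : ℂ))
    (d := ((PowerSeries.coeff (2 * m) harmonicKernelPowerSeries : ℝ) : ℂ))
    (Complex.inv_Gamma_isBigO hm) hE
  obtain ⟨k, hk⟩ : ∃ k, 2 * m = k + 1 := ⟨2 * m - 1, by lia⟩
  have hkC : 2 * (m : ℂ) = k + 1 := by exact_mod_cast hk
  have hk0 : (k : ℂ) + 1 ≠ 0 := by exact_mod_cast k.succ_ne_zero
  have hf0 : (k.factorial : ℂ) ≠ 0 := by exact_mod_cast k.factorial_ne_zero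
  have hΓ : Complex.Gamma (2 * m) = k.factorial := by rw [hkC, Complex.Gamma_nat_eq_factorial]
  have hψ : deriv Complex.Gamma (2 * m) = k.factorial * Complex.digamma (2 * m) := by
    rw [Complex.digamma_def, logDeriv_apply, hΓ]
    field_simp
  have hζ : riemannZeta (1 - 2 * (m : ℂ)) = -((bernoulli' (k + 1) : ℚ) : ℂ) / (k + 1) := by
    rw [← riemannZeta_neg_nat_eq_bernoulli', hkC]
    congr 1
    ring
  have hc : ((PowerSeries.coeff (2 * m) (bernoulli'PowerSeries ℝ) : ℝ) : ℂ) =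
      ((bernoulli' (k + 1) : ℚ) : ℂ) / ((k + 1) * k.factorial) := by
    rw [hk]
    simp [bernoulli'PowerSeries, Nat.factorial_succ]
  have hd : ((PowerSeries.coeff (2 * m) harmonicKernelPowerSeries : ℝ) : ℂ) =
      ((bernoulli' k : ℚ) : ℂ) / k.factorial - ((bernoulliConv (k + 1) : ℚ) : ℂ) := by
    rw [hk, coeff_harmonicKernelPowerSeries_succ]
    push_cast
    rfl
  have hH := hh.eventuallyEq isEulerSumExtension_eulerSum (1 - 2 * m)
  have hH2 := (eulerSum_eventuallyEq (2 * m + 2) (s := 1 - 2 * m) (by simp)).filter_mono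
    (nhdsWithin_le_nhds (s := {(1 - 2 * m : ℂ)}ᶜ))
  refine key.congr' ?_ (Eventually.of_forall fun s => by ring)
  filter_upwards [hH, hH2] with s hs1 hs2
  rw [hs1, hs2, hEs, hζ, hψ, hΓ, hc, hd, hk, Nat.add_sub_cancel]
  rw [show s + 2 * (m : ℂ) - 1 = s - (1 - 2 * m) by ring]
  field_simp
  ring

lemma bernoulliConv_two : bernoulliConv 2 = 7 / 24 := by
  rw [bernoulliConv, Finset.sum_filter, Finset.Nat.antidiagonal_succ]
  simp [Finset.Nat.antidiagonal_succ, Nat.factorial]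
  norm_num

theorem corollary3 :
    (∃ h : ℂ → ℂ, IsEulerSumExtension h) ∧
    bernoulliConv 2 = 7 / 24 ∧
    ∀ h : ℂ → ℂ, IsEulerSumExtension h →
      (∀ m : ℕ, 2 ≤ m →
        (fun s : ℂ => h s -
          (riemannZeta (1 - 2 * (m : ℂ)) / (s + 2 * (m : ℂ) - 1)
            + ((2 * m - 1).factorial : ℂ) * ((bernoulliConv (2 * m) : ℚ) : ℂ)
            - Complex.digamma (2 * (m : ℂ)) * riemannZeta (1 - 2 * (m : ℂ))))
          =O[𝓝[≠] (1 - 2 * (m : ℂ))] (fun s : ℂ => s + 2 * (m : ℂ) - 1)) ∧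
      (fun s : ℂ => h s -
          (-1 / (12 * (s + 1)) - 1 / 8 - (Real.eulerMascheroniConstant : ℂ) / 12))
        =O[𝓝[≠] (-1 : ℂ)] (fun s : ℂ => s + 1) := by
  refine ⟨⟨eulerSum, isEulerSumExtension_eulerSum⟩, bernoulliConv_two, fun h hh =>
    ⟨fun m hm => ?_, ?_⟩⟩
  · have hB : bernoulli' (2 * m - 1) = 0 :=
      bernoulli'_eq_zero_of_odd ⟨m - 1, by lia⟩ (by lia)
    simpa [hB] using hh.isBigO_sub_principalPart (m := m) (by lia)
  -- The constant term is 7/24 - 1/2 + (1-γ)/12 = -1/8 - γ/12, with ψ(2) = 1 - γ.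
  · have key := hh.isBigO_sub_principalPart one_pos
    have hζ : riemannZeta (-1) = -1 / 12 := by
      have := riemannZeta_neg_nat_eq_bernoulli' 1
      norm_num at this
      rw [this]
      norm_num
    have hψ : Complex.digamma 2 = 1 - Real.eulerMascheroniConstant := by
      have := Complex.digamma_apply_add_one 1 fun m hm => by
        have := congrArg Complex.re hm
        simp at this
        linarith [(Nat.cast_nonneg m : (0 : ℝ) ≤ m)]
      rw [Complex.digamma_one, one_add_one_eq_two] at this
      rw [this]
      ring
    have h1 : (1 : ℂ) - 2 * ((1 : ℕ) : ℂ) = -1 := by norm_num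
    have h2 : (2 : ℂ) * ((1 : ℕ) : ℂ) = 2 := by norm_num
    rw [h1, h2, hζ, hψ, mul_one, bernoulliConv_two] at key
    refine key.congr (fun s => ?_) fun s => by ring
    rw [show s + 2 - 1 = s + 1 by ring, ← div_div]
    norm_num [bernoulli'_one]
    ring
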